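/- Let $N\ge 3$, $\mu\in\mathbb R$, $\sigma>0$, and let $Y_i=\mu+\epsilon_i$, $i=1,\dots,N$, with $\epsilon_1,\dots,\epsilon_N$ i.i.d. $\mathrm N(0,\sigma^2)$; write $\bar Y=\frac1N\sum_i Y_i$, and let $\mathbf 1\in\mathbb R^N$ be the vector of ones. Let $B$ be the $(N-1)\times N$ finite difference matrix, $(Bf)_i=f_{i+1}-f_i$. For $\lambda\ge0$ the total variation (TV) estimate $\hat f_\lambda$ is the unique minimizer over $f\in\mathbb R^N$ of $\frac12\|Y-f\|_2^2+\lambda\|Bf\|_1$. Let $$\Lambda=\min\{\|w\|_\infty : w\in\mathbb R^{N-1},\ Y-B^{T}w=\bar Y\mathbf 1\}.$$ A universal threshold for TV is a $(1-\alpha_N)$-quantile of $\Lambda$ (the least $t$ with $\mathbb P(\Lambda\le t)\ge 1-\alpha_N$), for levels $\alpha_N\in(0,1)$ with $\alpha_N=O(1/\sqrt{\log (N-1)})$ as $N\to\infty$, where $N-1$ is the number of rows of $B$. Put $$\lambda_N=\frac{\sigma}{2}\sqrt{N\log\log N}.$$ Then: (i) $\lambda_N$ is a universal threshold for TV: there is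 a sequence $(\alpha_N)$, depending only on $N$ (not on $\mu$, $\sigma$ or the probability space), with $\alpha_N=O(1/\sqrt{\log(N-1)})$ and, for every $N\ge3$, $0<\alpha_N<1$ and $\alpha_N\le 2/\sqrt{\log N}$, such that for every $N\ge3$, every $\mu\in\mathbb R$ and every $\sigma>0$, $\lambda_N$ is the $(1-\alpha_N)$-quantile of $\Lambda$. (ii) For every $N\ge3$, every $\mu\in\mathbb R$ and every $\sigma>0$, $$\mathbb P\big(\hat f_{\lambda_N}=\bar Y\,\mathbf 1\big)\ \ge\ 1-\frac{2}{\sqrt{\log N}}.$$ -/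

import Mathlib

open MeasureTheory ProbabilityTheory Asymptotics Filter
open scoped Matrix

noncomputable section

namespace TVDenoising

/-- The finite difference matrix in dimension one, of size `(N - 1) × N`:
`(B f) i = f (i + 1) - f i`. -/
def diffMatrix (N : ℕ) : Matrix (Fin (N - 1)) (Fin N) ℝ :=
  fun i j => if (j : ℕ) = (i : ℕ) + 1 then 1 else if (j : ℕ) = (i : ℕ) then -1 else 0

/-- The TV cost `(1/2) ‖y - f‖₂² + lam * ‖B f‖₁`. -/
def tvCost {N : ℕ} (y : Fin N → ℝ) (lam : ℝ) (f : Fin N → ℝ) : ℝ :=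
  (1 / 2) * ∑ i, (y i - f i) ^ 2 + lam * ∑ i, |(diffMatrix N *ᵥ f) i|

/-- `f` is a TV estimate for the data `y` and the threshold `lam`: a global minimizer of the
TV cost. -/
def IsTVEstimate {N : ℕ} (y : Fin N → ℝ) (lam : ℝ) (f : Fin N → ℝ) : Prop :=
  IsMinOn (tvCost y lam) Set.univ f

/-- The mean of the data. -/
def mean {N : ℕ} (y : Fin N → ℝ) : ℝ := (∑ i, y i) / N

/-- The values `‖w‖_∞` of the dual vectors `w` with `y - Bᵀ w = mean y • 1`
(the norm on `Fin (N - 1) → ℝ` is the sup norm). -/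
def dualNorms {N : ℕ} (y : Fin N → ℝ) : Set ℝ :=
  {r | ∃ w : Fin (N - 1) → ℝ, y - (diffMatrix N)ᵀ *ᵥ w = (fun _ => mean y) ∧ r = ‖w‖}

/-- The minimal threshold `Λ = min ‖w‖_∞` subject to `y - Bᵀ w = mean y • 1`; the minimum is
attained, see `isLeast_minThreshold`. -/
def minThreshold {N : ℕ} (y : Fin N → ℝ) : ℝ := sInf (dualNorms y)

/-- `q` is the `p`-quantile of the real random variable `X`: the least `t` with
`P (X ≤ t) ≥ p`. -/
def IsQuantile {Ω : Type*} [MeasurableSpace Ω] (P : Measure Ω) (X : Ω → ℝ) (p q : ℝ) : Prop :=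
  IsLeast {t : ℝ | p ≤ P.real {ω | X ω ≤ t}} q

/-- The closed form `(σ / 2) * √(N log log N)`. -/
def univThreshold (σ : ℝ) (N : ℕ) : ℝ := σ / 2 * √(N * Real.log (Real.log N))

theorem transpose_mulVec_succ (n : ℕ) (w : Fin n → ℝ) (j : Fin (n + 1)) :
    ((diffMatrix (n + 1))ᵀ *ᵥ w) j =
      (if h : 0 < (j : ℕ) then w ⟨j - 1, by omega⟩ else 0)
        - (if h : (j : ℕ) < n then w ⟨j, h⟩ else 0) := by
  have e : ∀ i : Fin n, diffMatrix (n + 1) i j * w i =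
      (if (j : ℕ) = (i : ℕ) + 1 then w i else 0) - (if (j : ℕ) = (i : ℕ) then w i else 0) := by
    intro i
    simp only [diffMatrix]
    split_ifs <;> first | omega | simp
  have h0 : ((diffMatrix (n + 1))ᵀ *ᵥ w) j = ∑ i : Fin n, diffMatrix (n + 1) i j * w i := rfl
  rw [h0, Finset.sum_congr rfl (fun i _ => e i), Finset.sum_sub_distrib]
  congr 1
  · split_ifs with h
    · rw [Finset.sum_eq_single (⟨j - 1, by omega⟩ : Fin n)]
      · rw [if_pos]; simp only; omega
      · intro b _ hb
        rw [if_neg]; intro hh; apply hb; ext; simp only; omega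
      · simp
    · apply Finset.sum_eq_zero; intro b _; rw [if_neg]; omega
  · split_ifs with h
    · rw [Finset.sum_eq_single (⟨j, h⟩ : Fin n)]
      · simp
      · intro b _ hb
        rw [if_neg]; intro hh; apply hb; ext; simp only; omega
      · simp
    · apply Finset.sum_eq_zero; intro b _; rw [if_neg]; have := b.2; omega

/-- The constraint set is a single point, so the minimum defining `minThreshold` is attained. -/
theorem isLeast_minThreshold {N : ℕ} (hN : 0 < N) (y : Fin N → ℝ) :
    IsLeast (dualNorms y) (minThreshold y) := by
  obtain ⟨n, rfl⟩ : ∃ n, N = n + 1 := ⟨N - 1, by omega⟩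
  -- existence of a dual vector
  let g : ℕ → ℝ := fun k => if h : k < n + 1 then y ⟨k, h⟩ - mean y else 0
  have hg : ∑ k ∈ Finset.range (n + 1), g k = 0 := by
    rw [Finset.sum_range]
    have : ∀ i : Fin (n + 1), g i = y i - mean y := fun i => dif_pos i.2
    rw [Finset.sum_congr rfl (fun i _ => this i), Finset.sum_sub_distrib]
    simp only [mean, Finset.sum_const, Finset.card_univ, Fintype.card_fin, nsmul_eq_mul]
    field_simp
    simp
  have hex : ∃ w : Fin n → ℝ, y - (diffMatrix (n + 1))ᵀ *ᵥ w = (fun _ => mean y) := by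
    refine ⟨fun i => - ∑ k ∈ Finset.range (i + 1), g k, ?_⟩
    ext j
    have hj : g j = y j - mean y := dif_pos j.2
    have ha : (if h : 0 < (j : ℕ) then - ∑ k ∈ Finset.range (j - 1 + 1), g k else 0)
        = - ∑ k ∈ Finset.range j, g k := by
      split_ifs with h
      · rw [Nat.sub_add_cancel h]
      · have : (j : ℕ) = 0 := by omega
        simp [this]
    have hb : (if h : (j : ℕ) < n then - ∑ k ∈ Finset.range (j + 1), g k else 0)
        = - ∑ k ∈ Finset.range (j + 1), g k := by
      split_ifs with h
      · rfl
      · have : (j : ℕ) = n := by omega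
        rw [this, hg, neg_zero]
    rw [Pi.sub_apply, transpose_mulVec_succ]
    simp only
    rw [ha, hb, Finset.sum_range_succ, hj]
    ring
  -- uniqueness
  have huniq : ∀ w v : Fin n → ℝ, (diffMatrix (n + 1))ᵀ *ᵥ w = (diffMatrix (n + 1))ᵀ *ᵥ v →
      w = v := by
    intro w v hwv
    have key : ∀ k (hk : k < n), w ⟨k, hk⟩ = v ⟨k, hk⟩ := by
      intro k
      induction k with
      | zero =>
        intro hk
        have := congrFun hwv ⟨0, by omega⟩
        rw [transpose_mulVec_succ, transpose_mulVec_succ] at this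
        simpa [hk] using this
      | succ k ih =>
        intro hk
        have := congrFun hwv ⟨k + 1, by omega⟩
        rw [transpose_mulVec_succ, transpose_mulVec_succ] at this
        simpa [hk, ih (by omega)] using this
    ext i
    exact key i i.2
  obtain ⟨w, hw⟩ := hex
  have hset : dualNorms y = {‖w‖} := by
    ext r
    simp only [dualNorms, Set.mem_ofPred_eq, Set.mem_singleton_iff]
    constructor
    · rintro ⟨v, hv, rfl⟩
      rw [huniq v w (sub_right_injective (hv.trans hw.symm))]
    · rintro rfl
      exact ⟨w, hw, rfl⟩
  rw [minThreshold, hset, csInf_singleton]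
  exact isLeast_singleton

end TVDenoising

end

/-!
Write `b k = ∑_{i < k} (Y i - mean Y)` for the bridge of the data. The only dual vector with
`Y - Bᵀ w = mean Y • 1` is `-b`, so `Λ = max_k |b k|` (`minThreshold_eq_norm_bridge`). This is
invariant under shifts of the data and homogeneous of degree one, so the law of `Λ / σ` is that of
`Λ` for standard Gaussian data (`measureReal_minThreshold_model`), and `α N` is defined as the
probability that the latter exceeds `√(N log log N) / 2`.

The threshold is then a quantile because the distribution function of `Λ` is strictly increasing on
`[0, ∞)` (`measureReal_minThreshold_le_lt`).

For `α N ≤ 2 / √(log N)`, the discrete bridge is shown to satisfy the tail bound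
`P (max_k b k ≥ a) ≤ exp (-2 a² / N)` of the Brownian bridge. Divided by the number `N - k` of
remaining observations, the bridge becomes the overall mean minus the mean of the remaining
observations, which is a Brownian motion sampled at the times `1 / (N - k) - 1 / N`
(`covariance_tailDev`), and the event `b k ≥ a` becomes the crossing of the line `a t + a / N`. The
crossing probability is bounded by Doob's maximal inequality for the exponential martingale
(`measureReal_exists_line_le`). A union bound over the two signs gives the factor `2`.

Finally, when `Λ ≤ lam`, the vector `-b` is a dual certificate, and the cost exceeds its value at
the constant fit by at least half the squared distance to it (`tvCost_mean_add_le`), so that the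
constant fit is the unique minimizer.
-/

namespace TVDenoising

/-! ### Line crossing for Gaussian processes with Brownian covariance -/

section LineCrossing

variable {Ω : Type*} [MeasurableSpace Ω] {P : Measure Ω} {D : ℕ → Ω → ℝ} {t : ℕ → ℝ}

theorem variance_increment (hD : IsGaussianProcess D P)
    (hcov : ∀ i j, cov[D i, D j; P] = t (min i j)) (k : ℕ) :
    Var[D (k + 1) - D k; P] = t (k + 1) - t k := by
  have := hD.isProbabilityMeasure
  have hL : ∀ k, MemLp (D k) 2 P := fun k => (hD.hasGaussianLaw_eval k).memLp_two
  rw [variance_sub (hL _) (hL _), ← covariance_self (hL _).aemeasurable,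
    ← covariance_self (hL _).aemeasurable, hcov, hcov, hcov]
  simp
  ring

/-- Uncorrelated increments of a Gaussian process are independent of the past. -/
theorem indep_increment_natural (hD : IsGaussianProcess D P)
    (hcov : ∀ i j, cov[D i, D j; P] = t (min i j)) (hm : ∀ k, StronglyMeasurable (D k)) (k : ℕ) :
    Indep (MeasurableSpace.comap (D (k + 1) - D k) inferInstance)
      (Filtration.natural D hm k) P := by
  have := hD.isProbabilityMeasure
  have hL : ∀ k, MemLp (D k) 2 P := fun k => (hD.hasGaussianLaw_eval k).memLp_two
  have hproc : IsGaussianProcess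
      (Sum.elim (fun (s : Set.Iic k) => D s) (fun _ : Unit => D (k + 1) - D k)) P := by
    refine hD.of_isGaussianProcess fun s => ?_
    rcases s with s | s
    · exact ⟨{(s : ℕ)}, .proj ⟨s, by simp⟩, fun ω => rfl⟩
    · exact ⟨{k + 1, k}, .proj ⟨k + 1, by simp⟩ - .proj ⟨k, by simp⟩, fun ω => rfl⟩
  have hind : IndepFun (fun ω (s : Set.Iic k) => D s ω)
      (fun ω (_ : Unit) => (D (k + 1) - D k) ω) P := by
    refine hproc.indepFun_of_covariance_eq_zero (fun s => (hm s).measurable.aemeasurable)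
      (fun _ => ((hm _).measurable.sub (hm _).measurable).aemeasurable) fun s _ => ?_
    rw [covariance_sub_right (hL _) (hL _) (hL _), hcov, hcov]
    have hs : (s : ℕ) ≤ k := s.2
    rw [min_eq_left hs, min_eq_left (by omega), sub_self]
  have hunit : Measurable fun u : Unit → ℝ => u () := measurable_pi_apply ()
  have h2 := (hind.comp measurable_id hunit).symm
  rw [IndepFun_iff_Indep] at h2
  refine indep_of_indep_of_le_right h2 ?_
  refine iSup₂_le fun j hj => ?_
  rw [Function.id_comp]
  rintro _ ⟨s, hs, rfl⟩
  exact ⟨(fun u : Set.Iic k → ℝ => u ⟨j, hj⟩) ⁻¹' s, measurable_pi_apply _ hs, rfl⟩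

/-- The exponential martingale `exp (c D - c² t / 2)`. -/
theorem submartingale_exp (hD : IsGaussianProcess D P)
    (hmean : ∀ k, P[D k] = 0) (hcov : ∀ i j, cov[D i, D j; P] = t (min i j))
    (hm : ∀ k, StronglyMeasurable (D k)) (c : ℝ) :
    Submartingale (fun k ω => Real.exp (c * D k ω - c ^ 2 * t k / 2))
      (Filtration.natural D hm) P := by
  have := hD.isProbabilityMeasure
  have hexp : ∀ X : Ω → ℝ, HasGaussianLaw X P → Integrable (fun ω => Real.exp (c * X ω)) P := by
    intro X hX
    have h := integrable_exp_mul_gaussianReal (μ := P[X]) (v := Var[X; P].toNNReal) c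
    rw [← hX.map_eq_gaussianReal] at h
    exact h.comp_aemeasurable hX.aemeasurable
  have hadp : StronglyAdapted (Filtration.natural D hm)
      (fun k ω => Real.exp (c * D k ω - c ^ 2 * t k / 2)) := by
    intro k
    have h : StronglyMeasurable[Filtration.natural D hm k] (D k) :=
      Filtration.stronglyAdapted_natural hm k
    exact Real.continuous_exp.comp_stronglyMeasurable
      ((h.const_mul c).sub stronglyMeasurable_const)
  have hint : ∀ k, Integrable (fun ω => Real.exp (c * D k ω - c ^ 2 * t k / 2)) P := by
    intro k
    simp only [Real.exp_sub]
    exact (hexp _ (hD.hasGaussianLaw_eval k)).div_const _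
  refine submartingale_nat hadp hint fun k => ?_
  set G : Ω → ℝ := fun ω => Real.exp (c * (D (k + 1) - D k) ω) with hG
  set M : Ω → ℝ := fun ω => Real.exp (c * D k ω - c ^ 2 * t k / 2) with hM
  set r : ℝ := Real.exp (-(c ^ 2 * (t (k + 1) - t k) / 2)) with hr
  have hprod : (fun ω => Real.exp (c * D (k + 1) ω - c ^ 2 * t (k + 1) / 2))
      = fun ω => M ω * (r * G ω) := by
    ext ω
    simp only [hM, hG, hr, ← Real.exp_add, Pi.sub_apply]
    congr 1
    ring
  have hGint : Integrable (fun ω => r * G ω) P := (hexp _ hD.hasGaussianLaw_sub).const_mul _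
  have hEG : ∫ ω, r * G ω ∂P = 1 := by
    have hv := variance_increment hD hcov k
    have hmg := mgf_gaussianReal
      (hD.hasGaussianLaw_sub (s := k + 1) (t := k)).map_eq_gaussianReal c
    have h0 : P[D (k + 1) - D k] = 0 := by
      rw [integral_sub' (hD.hasGaussianLaw_eval _).integrable
        (hD.hasGaussianLaw_eval _).integrable, hmean, hmean, sub_zero]
    rw [h0, hv, Real.coe_toNNReal _ (hv ▸ variance_nonneg _ _)] at hmg
    rw [integral_const_mul]
    change r * mgf (D (k + 1) - D k) P c = 1
    rw [hmg, hr, ← Real.exp_add, Real.exp_eq_one_iff]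
    ring
  have hce : P[fun ω => r * G ω | Filtration.natural D hm k] =ᵐ[P] fun _ => 1 := by
    have h := condExp_indep_eq (μ := P) (f := fun ω => r * G ω)
      (m₁ := MeasurableSpace.comap (D (k + 1) - D k) inferInstance)
      (m₂ := Filtration.natural D hm k)
      (((hm _).measurable.sub (hm _).measurable).comap_le) ((Filtration.natural D hm).le k) ?_
      (indep_increment_natural hD hcov hm k)
    · rwa [hEG] at h
    · have : Measurable[MeasurableSpace.comap (D (k + 1) - D k) inferInstance]
          (D (k + 1) - D k) := comap_measurable _
      exact (((this.const_mul c).exp).const_mul r).stronglyMeasurable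
  rw [hprod]
  have hpull := condExp_mul_of_stronglyMeasurable_left (μ := P)
    (m := Filtration.natural D hm k) (f := M) (g := fun ω => r * G ω) (hadp k)
    (by have := hint (k + 1); rwa [hprod] at this) hGint
  filter_upwards [hpull, hce] with ω h1 h2
  rw [show (fun ω => M ω * (r * G ω)) = M * fun ω => r * G ω from rfl, h1, Pi.mul_apply, h2,
    mul_one]

/-- **Line crossing bound.** A centered Gaussian process on `ℕ` with the covariance of a Brownian
motion sampled at the times `t k` crosses the line `a t + b` with probability at most
`exp (-2 a b)`, as the Brownian motion does. -/
theorem measureReal_exists_line_le (hD : IsGaussianProcess D P)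
    (hmean : ∀ k, P[D k] = 0) (hcov : ∀ i j, cov[D i, D j; P] = t (min i j))
    (hm : ∀ k, StronglyMeasurable (D k)) {a b : ℝ} (ha : 0 ≤ a) (n : ℕ) :
    P.real {ω | ∃ k ≤ n, a * t k + b ≤ D k ω} ≤ Real.exp (-(2 * a * b)) := by
  have := hD.isProbabilityMeasure
  have hsub := submartingale_exp hD hmean hcov hm (2 * a)
  set M : ℕ → Ω → ℝ := fun k ω => Real.exp (2 * a * D k ω - (2 * a) ^ 2 * t k / 2) with hM
  have hnn : 0 ≤ M := fun k ω => (Real.exp_pos _).le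
  set e : NNReal := (Real.exp (2 * a * b)).toNNReal with he
  have hee : (e : ℝ) = Real.exp (2 * a * b) := Real.coe_toNNReal _ (Real.exp_pos _).le
  set S := {ω | (e : ℝ) ≤ (Finset.range (n + 1)).sup' Finset.nonempty_range_add_one
    fun k => M k ω} with hS
  have hmax : e * P S ≤ ENNReal.ofReal (∫ ω in S, M n ω ∂P) := maximal_ineq hsub hnn n
  have hone : ∫ ω, M n ω ∂P = 1 := by
    have hL := (hD.hasGaussianLaw_eval n)
    have hmg := mgf_gaussianReal hL.map_eq_gaussianReal (2 * a)
    have hv : Var[D n; P] = t n := by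
      rw [← covariance_self hL.aemeasurable, hcov, min_self]
    rw [hmean, hv, Real.coe_toNNReal _ (hv ▸ variance_nonneg _ _)] at hmg
    simp only [hM, Real.exp_sub]
    rw [integral_div]
    change mgf (D n) P (2 * a) / _ = 1
    rw [hmg, ← Real.exp_sub, Real.exp_eq_one_iff]
    ring
  have hle : ∫ ω in S, M n ω ∂P ≤ 1 :=
    hone ▸ setIntegral_le_integral (hsub.integrable n) (ae_of_all _ (hnn n))
  have hreal : Real.exp (2 * a * b) * P.real S ≤ 1 := by
    have h := ENNReal.toReal_mono ENNReal.ofReal_ne_top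
      (hmax.trans (ENNReal.ofReal_le_ofReal hle))
    simpa [hee, Measure.real] using h
  have hsubset : {ω | ∃ k ≤ n, a * t k + b ≤ D k ω} ⊆ S := by
    rintro ω ⟨k, hk, h⟩
    refine le_trans ?_ (Finset.le_sup' (fun k => M k ω) (Finset.mem_range.2 (by omega : k < n + 1)))
    rw [hee]
    -- `D ≥ a t + b` gives `2 a D - 2 a² t ≥ 2 a b`
    refine Real.exp_le_exp.2 ?_
    nlinarith
  calc _ ≤ P.real S := measureReal_mono hsubset
    _ ≤ _ := by
      rw [Real.exp_neg, ← one_div, le_div_iff₀ (Real.exp_pos _), mul_comm]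
      exact hreal

end LineCrossing

/-! ### The bridge and the minimal threshold -/

section Bridge

variable {n : ℕ}

/-- The bridge `k ↦ ∑_{i < k} (y i - mean y)` of the data. -/
noncomputable def bridge (y : Fin (n + 1) → ℝ) (k : ℕ) : ℝ :=
  ∑ i : Fin (n + 1), if (i : ℕ) < k then y i - mean y else 0

theorem bridge_zero (y : Fin (n + 1) → ℝ) : bridge y 0 = 0 := by
  simp [bridge]

theorem bridge_succ (y : Fin (n + 1) → ℝ) (i : Fin (n + 1)) :
    bridge y (i + 1) = bridge y i + (y i - mean y) := by
  have h : y i - mean y = ∑ j : Fin (n + 1), if j = i then y j - mean y else 0 := by simp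
  rw [bridge, bridge, h, ← Finset.sum_add_distrib]
  refine Finset.sum_congr rfl fun j _ => ?_
  rcases lt_trichotomy (j : ℕ) i with hj | hj | hj
  · rw [if_pos (by omega), if_pos hj, if_neg (fun h => by simp [h] at hj), add_zero]
  · rw [if_pos (by omega), if_neg (by omega), if_pos (Fin.ext hj), zero_add]
  · rw [if_neg (by omega), if_neg (by omega), if_neg (fun h => by simp [h] at hj), add_zero]

/-- The dual vector with `y - Bᵀ w = mean y • 1` is minus the bridge, so that the minimal
threshold is the largest absolute value of the bridge. -/
theorem minThreshold_eq_norm_bridge (y : Fin (n + 1) → ℝ) :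
    minThreshold y = ‖fun i : Fin n => bridge y (i + 1)‖ := by
  obtain ⟨w, hw, hr⟩ := (isLeast_minThreshold n.succ_pos y).1
  rw [hr, ← norm_neg w]
  congr 1
  have hw' : ∀ j : Fin (n + 1), (if h : 0 < (j : ℕ) then w ⟨j - 1, by omega⟩ else 0)
      - (if h : (j : ℕ) < n then w ⟨j, h⟩ else 0) = y j - mean y := by
    intro j
    have h := congrFun hw j
    have h' := transpose_mulVec_succ n w j
    change y j - ((diffMatrix (n + 1))ᵀ *ᵥ w) j = mean y at h
    linarith
  have key : ∀ k (hk : k < n), -w ⟨k, hk⟩ = bridge y (k + 1) := by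
    intro k
    induction k with
    | zero =>
      intro hk
      have h1 := hw' ⟨0, by omega⟩
      have h2 := bridge_succ y ⟨0, by omega⟩
      simp only [lt_irrefl, dite_false, hk, dite_true, bridge_zero] at h1 h2
      rw [h2, ← h1]
      ring
    | succ k ih =>
      intro hk
      have h1 := hw' ⟨k + 1, by omega⟩
      have h2 := bridge_succ y ⟨k + 1, by omega⟩
      simp only [Nat.succ_pos, hk, dite_true, Nat.add_sub_cancel] at h1 h2
      rw [h2, ← ih (by omega), ← h1]
      ring
  ext i
  exact key i i.2

theorem minThreshold_nonneg (y : Fin (n + 1) → ℝ) : 0 ≤ minThreshold y := by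
  rw [minThreshold_eq_norm_bridge]
  exact norm_nonneg _

theorem mean_affine (m σ : ℝ) (x : Fin (n + 1) → ℝ) :
    mean (fun i => m + σ * x i) = m + σ * mean x := by
  simp only [mean, Finset.sum_add_distrib, Finset.sum_const, Finset.card_univ, Fintype.card_fin,
    nsmul_eq_mul, ← Finset.mul_sum]
  field_simp

theorem bridge_affine (m σ : ℝ) (x : Fin (n + 1) → ℝ) (k : ℕ) :
    bridge (fun i => m + σ * x i) k = σ * bridge x k := by
  rw [bridge, bridge, mean_affine, Finset.mul_sum]
  refine Finset.sum_congr rfl fun i _ => ?_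
  split_ifs <;> ring

theorem minThreshold_affine (m : ℝ) {σ : ℝ} (hσ : 0 ≤ σ) (x : Fin (n + 1) → ℝ) :
    minThreshold (fun i => m + σ * x i) = σ * minThreshold x := by
  simp only [minThreshold_eq_norm_bridge, bridge_affine]
  rw [show (fun i : Fin n => σ * bridge x (i + 1)) = σ • fun i : Fin n => bridge x (i + 1) from rfl,
    norm_smul, Real.norm_of_nonneg hσ]

theorem continuous_minThreshold :
    Continuous (minThreshold : (Fin (n + 1) → ℝ) → ℝ) := by
  have h : (minThreshold : (Fin (n + 1) → ℝ) → ℝ)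
      = fun y => ‖fun i : Fin n => bridge y (i + 1)‖ := funext minThreshold_eq_norm_bridge
  rw [h]
  refine (continuous_pi fun i => ?_).norm
  unfold bridge mean
  refine continuous_finsetSum _ fun j _ => ?_
  split_ifs <;> fun_prop

/-- With at least two observations the minimal threshold takes every nonnegative value. -/
theorem exists_minThreshold_eq (hn : 0 < n) {r : ℝ} (hr : 0 ≤ r) :
    ∃ y : Fin (n + 1) → ℝ, minThreshold y = r := by
  -- any vector with a nonzero first entry of the bridge can be rescaled
  set e : Fin (n + 1) → ℝ := Pi.single 0 1 with he
  have hmean : mean e = 1 / (n + 1) := by simp [mean, he]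
  have hb : bridge e 1 = 1 - 1 / (n + 1) := by
    have h := bridge_succ e 0
    rw [hmean] at h
    simpa [bridge_zero, he] using h
  have hpos : 0 < bridge e 1 := by
    rw [hb, sub_pos, div_lt_one (by positivity)]
    have : (0 : ℝ) < n := by exact_mod_cast hn
    linarith
  have hL : 0 < minThreshold e := by
    rw [minThreshold_eq_norm_bridge]
    refine lt_of_lt_of_le hpos ((le_abs_self _).trans ?_)
    exact norm_le_pi_norm (fun i : Fin n => bridge e (i + 1)) ⟨0, hn⟩
  refine ⟨fun i => 0 + r / minThreshold e * e i, ?_⟩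
  rw [minThreshold_affine 0 (by positivity), div_mul_cancel₀ _ hL.ne']

theorem exists_le_bridge_of_lt_minThreshold (y : Fin (n + 1) → ℝ) {r : ℝ} (hr : 0 < r)
    (h : r < minThreshold y) : ∃ k ≤ n, r ≤ bridge y k ∨ r ≤ -bridge y k := by
  by_contra! hcon
  refine h.not_ge ?_
  rw [minThreshold_eq_norm_bridge, pi_norm_le_iff_of_nonneg hr.le]
  intro i
  obtain ⟨h1, h2⟩ := hcon (i + 1) i.2
  rw [Real.norm_eq_abs, abs_le]
  constructor <;> linarith

end Bridge

/-! ### Dual certificate for the constant fit -/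

section Minimizer

variable {N : ℕ}

/-- If `y - mean y • 1 = Bᵀ w` with `‖w‖_∞ ≤ lam`, then the cost grows quadratically away from
the constant fit. -/
theorem tvCost_mean_add_le (hN : 0 < N) (y f : Fin N → ℝ) {lam : ℝ} (h : minThreshold y ≤ lam) :
    tvCost y lam (fun _ => mean y) + 1 / 2 * ∑ i, (mean y - f i) ^ 2 ≤ tvCost y lam f := by
  obtain ⟨w, hw, hr⟩ := (isLeast_minThreshold hN y).1
  set c := mean y with hc
  have hconst : diffMatrix N *ᵥ (fun _ => c) = 0 := by
    ext i
    have e : ∀ j : Fin N, diffMatrix N i j * c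
        = (if j = ⟨i + 1, by omega⟩ then c else 0) - (if j = ⟨i, by omega⟩ then c else 0) := by
      intro j
      simp only [diffMatrix, Fin.ext_iff]
      split_ifs <;> first | omega | simp
    change ∑ j, diffMatrix N i j * c = 0
    rw [Finset.sum_congr rfl fun j _ => e j, Finset.sum_sub_distrib]
    simp
  have hy : ∀ i, y i - c = ((diffMatrix N)ᵀ *ᵥ w) i := by
    intro i
    have := congrFun hw i
    rw [Pi.sub_apply] at this
    linarith
  -- `⟨y - c, f - c⟩ = ⟨Bᵀ w, f - c⟩ = ⟨w, B f⟩`, since `B` annihilates constants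
  have hdual : ∑ i, (y i - c) * f i - ∑ i, (y i - c) * c = ∑ i, w i * (diffMatrix N *ᵥ f) i := by
    have hg : ∀ g : Fin N → ℝ,
        ∑ i, (y i - c) * g i = ∑ i, w i * (diffMatrix N *ᵥ g) i := by
      intro g
      have h1 : ∑ i, (y i - c) * g i = ((diffMatrix N)ᵀ *ᵥ w) ⬝ᵥ g :=
        Finset.sum_congr rfl fun i _ => by rw [hy]
      rw [h1, Matrix.mulVec_transpose, ← Matrix.dotProduct_mulVec]
      rfl
    rw [hg f, hg fun _ => c, hconst]
    simp
  have hbound : ∑ i, w i * (diffMatrix N *ᵥ f) i ≤ lam * ∑ i, |(diffMatrix N *ᵥ f) i| := by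
    rw [Finset.mul_sum]
    refine Finset.sum_le_sum fun i _ => (le_abs_self _).trans ?_
    rw [abs_mul]
    exact mul_le_mul_of_nonneg_right ((norm_le_pi_norm w i).trans (hr ▸ h)) (abs_nonneg _)
  have hsq : ∑ i, (y i - f i) ^ 2 = ∑ i, (y i - c) ^ 2 + ∑ i, (c - f i) ^ 2
      - 2 * (∑ i, (y i - c) * f i - ∑ i, (y i - c) * c) := by
    rw [← Finset.sum_sub_distrib, Finset.mul_sum, ← Finset.sum_add_distrib,
      ← Finset.sum_sub_distrib]
    refine Finset.sum_congr rfl fun i _ => ?_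
    ring
  rw [tvCost, tvCost, hconst, hsq, hdual]
  simp only [Pi.zero_apply, abs_zero, Finset.sum_const_zero, mul_zero]
  linarith

theorem isTVEstimate_iff_eq_mean (hN : 0 < N) (y f : Fin N → ℝ) {lam : ℝ}
    (h : minThreshold y ≤ lam) : IsTVEstimate y lam f ↔ f = fun _ => mean y := by
  constructor
  · intro hf
    have h1 := tvCost_mean_add_le hN y f h
    have h2 : tvCost y lam f ≤ tvCost y lam fun _ => mean y := hf (Set.mem_univ _)
    have h3 : ∑ i, (mean y - f i) ^ 2 = 0 :=
      le_antisymm (by linarith) (Finset.sum_nonneg fun i _ => sq_nonneg _)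
    ext i
    have h4 := (Finset.sum_eq_zero_iff_of_nonneg fun i _ => sq_nonneg _).1 h3 i (Finset.mem_univ i)
    exact (sub_eq_zero.1 (pow_eq_zero_iff two_ne_zero |>.1 h4)).symm
  · rintro rfl g -
    have h1 := tvCost_mean_add_le hN y g h
    have h2 : 0 ≤ ∑ i, (mean y - g i) ^ 2 := Finset.sum_nonneg fun i _ => sq_nonneg _
    change tvCost y lam (fun _ => mean y) ≤ tvCost y lam g
    linarith

end Minimizer

/-! ### Tail bound for the Gaussian bridge -/

section GaussianBridge

/-- The law of `N` independent standard Gaussian variables. -/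
noncomputable abbrev stdGaussianPi (N : ℕ) : Measure (Fin N → ℝ) :=
  Measure.pi fun _ => gaussianReal 0 1

instance isOpenPosMeasure_stdGaussianPi (N : ℕ) : (stdGaussianPi N).IsOpenPosMeasure := by
  have : (gaussianReal 0 1).IsOpenPosMeasure :=
    (gaussianReal_absolutelyContinuous' 0 one_ne_zero).isOpenPosMeasure
  infer_instance

theorem hasGaussianLaw_stdGaussianPi (N : ℕ) :
    HasGaussianLaw (fun (x : Fin N → ℝ) i => x i) (stdGaussianPi N) := by
  refine iIndepFun.hasGaussianLaw (X := fun i (x : Fin N → ℝ) => x i) (fun i => ?_) ?_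
  · exact (measurePreserving_eval (fun _ : Fin N => gaussianReal 0 1) i).hasLaw.hasGaussianLaw
  · exact iIndepFun_pi (X := fun _ => id) fun _ => aemeasurable_id

theorem covariance_linear_stdGaussianPi {N : ℕ} (c d : Fin N → ℝ) :
    cov[fun x : Fin N → ℝ => ∑ i, c i * x i, fun x => ∑ i, d i * x i; stdGaussianPi N]
      = ∑ i, c i * d i := by
  have hL : ∀ i, MemLp (fun x : Fin N → ℝ => x i) 2 (stdGaussianPi N) := fun i =>
    ((hasGaussianLaw_stdGaussianPi N).eval (X := fun i (x : Fin N → ℝ) => x i) i).memLp_two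
  have hlaw : ∀ i, HasLaw (fun x : Fin N → ℝ => x i) (gaussianReal 0 1) (stdGaussianPi N) :=
    fun i => (measurePreserving_eval (fun _ : Fin N => gaussianReal 0 1) i).hasLaw
  have hcov : ∀ i j, cov[fun x : Fin N → ℝ => x i, fun x => x j; stdGaussianPi N]
      = if i = j then 1 else 0 := by
    intro i j
    split_ifs with h
    · subst h
      rw [covariance_self (hL i).aemeasurable, (hlaw i).variance_eq]
      simp
    · have hi : iIndepFun (fun i (x : Fin N → ℝ) => x i) (stdGaussianPi N) :=
        iIndepFun_pi (X := fun _ => id) fun _ => aemeasurable_id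
      exact (hi.indepFun h).covariance_eq_zero (hL i) (hL j)
  rw [covariance_fun_sum_fun_sum (fun i => (hL i).const_mul _) fun i => (hL i).const_mul _]
  simp [covariance_const_mul_left, covariance_const_mul_right, hcov, mul_comm]

theorem integral_linear_stdGaussianPi {N : ℕ} (c : Fin N → ℝ) :
    ∫ x, ∑ i, c i * x i ∂(stdGaussianPi N) = 0 := by
  have hL : ∀ i, Integrable (fun x : Fin N → ℝ => x i) (stdGaussianPi N) := fun i =>
    ((hasGaussianLaw_stdGaussianPi N).eval (X := fun i (x : Fin N → ℝ) => x i) i).integrable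
  have hlaw : ∀ i, HasLaw (fun x : Fin N → ℝ => x i) (gaussianReal 0 1) (stdGaussianPi N) :=
    fun i => (measurePreserving_eval (fun _ : Fin N => gaussianReal 0 1) i).hasLaw
  rw [integral_finsetSum _ fun i _ => (hL i).const_mul _]
  refine Finset.sum_eq_zero fun i _ => ?_
  rw [integral_const_mul, (hlaw i).integral_eq, integral_id_gaussianReal, mul_zero]

theorem isGaussianProcess_linear_stdGaussianPi {N : ℕ} {T : Type*} (c : T → Fin N → ℝ) :
    IsGaussianProcess (fun t (x : Fin N → ℝ) => ∑ i, c t i * x i) (stdGaussianPi N) where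
  hasGaussianLaw I := by
    let L : (Fin N → ℝ) →L[ℝ] (I → ℝ) :=
      ContinuousLinearMap.pi fun s => ∑ i, c s i • ContinuousLinearMap.proj i
    have hL : (fun x : Fin N → ℝ => I.restrict fun t => ∑ i, c t i * x i) = L ∘ fun x i => x i := by
      ext x s
      simp [L]
    rw [hL]
    exact (hasGaussianLaw_stdGaussianPi N).map L

variable {n : ℕ}

/-- The coefficients of the average of the observations with index at least `k`. -/
noncomputable def tailCoeff (n k : ℕ) (i : Fin (n + 1)) : ℝ :=
  if k ≤ i then 1 / ((n : ℝ) + 1 - k) else 0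

theorem sum_ite_le (k : ℕ) (hk : k ≤ n) :
    (∑ i : Fin (n + 1), if k ≤ (i : ℕ) then (1 : ℝ) else 0) = n + 1 - k := by
  rw [Fin.sum_univ_eq_sum_range (fun i => if k ≤ i then (1 : ℝ) else 0) (n + 1),
    Finset.sum_boole]
  have : Finset.filter (fun i => k ≤ i) (Finset.range (n + 1)) = Finset.Ico k (n + 1) := by
    ext i
    simp [and_comm]
  rw [this, Nat.card_Ico, Nat.cast_sub (by omega)]
  push_cast
  ring

theorem sum_tailCoeff_mul (j k : ℕ) (hj : j ≤ n) (hk : k ≤ n) :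
    ∑ i, tailCoeff n j i * tailCoeff n k i = 1 / ((n : ℝ) + 1 - (min j k : ℕ)) := by
  wlog h : j ≤ k generalizing j k
  · rw [min_comm, ← this k j hk hj (by omega)]
    exact Finset.sum_congr rfl fun i _ => mul_comm _ _
  have e : ∀ i, tailCoeff n j i * tailCoeff n k i
      = 1 / ((n : ℝ) + 1 - j) * (1 / ((n : ℝ) + 1 - k)) * if k ≤ (i : ℕ) then 1 else 0 := by
    intro i
    simp only [tailCoeff]
    split_ifs <;> first | omega | simp
  have hk' : (k : ℝ) ≤ n := by exact_mod_cast hk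
  have : (n : ℝ) + 1 - k ≠ 0 := by linarith
  rw [Finset.sum_congr rfl fun i _ => e i, ← Finset.mul_sum, sum_ite_le k hk, min_eq_left h]
  field_simp

/-- The difference between the mean of all observations and the mean of those with index at least
`min k n`. Capping the index at `n` keeps the second average nonempty; for `k ≤ n` this is the bridge
divided by the number of remaining observations. -/
noncomputable def tailDev (n k : ℕ) (y : Fin (n + 1) → ℝ) : ℝ :=
  ∑ i, (tailCoeff n 0 i - tailCoeff n (min k n) i) * y i

/-- The variance of `tailDev n k` for standard Gaussian data. -/
noncomputable def tailVar (n k : ℕ) : ℝ := 1 / ((n : ℝ) + 1 - (min k n : ℕ)) - 1 / ((n : ℝ) + 1)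

theorem covariance_tailDev (j k : ℕ) :
    cov[tailDev n j, tailDev n k; stdGaussianPi (n + 1)] = tailVar n (min j k) := by
  have h := covariance_linear_stdGaussianPi (fun i => tailCoeff n 0 i - tailCoeff n (min j n) i)
    (fun i => tailCoeff n 0 i - tailCoeff n (min k n) i)
  -- the terms pairing the mean of all data with another average are all `1 / (n + 1)`
  have hmin : min (min j k) n = min (min j n) (min k n) := by omega
  change cov[tailDev n j, tailDev n k; stdGaussianPi (n + 1)] = _ at h
  rw [h]
  simp only [sub_mul, mul_sub, Finset.sum_sub_distrib]
  rw [sum_tailCoeff_mul _ _ (by omega) (by omega), sum_tailCoeff_mul _ _ (by omega) (by omega),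
    sum_tailCoeff_mul _ _ (by omega) (by omega), sum_tailCoeff_mul _ _ (by omega) (by omega),
    tailVar, hmin]
  simp

theorem bridge_eq_mul_tailDev (y : Fin (n + 1) → ℝ) {k : ℕ} (hk : k ≤ n) :
    bridge y k = ((n : ℝ) + 1 - k) * tailDev n k y := by
  have hk' : (k : ℝ) ≤ n := by exact_mod_cast hk
  have h0 : (n : ℝ) + 1 - k ≠ 0 := by linarith
  have hm : ∑ i, tailCoeff n 0 i * y i = mean y := by
    simp [tailCoeff, mean, ← Finset.mul_sum, div_eq_inv_mul]
  have hb : bridge y k = ∑ i, (y i - mean y)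
      - ∑ i : Fin (n + 1), (y i * (if k ≤ (i : ℕ) then 1 else 0)
        - mean y * (if k ≤ (i : ℕ) then 1 else 0)) := by
    rw [bridge, ← Finset.sum_sub_distrib]
    refine Finset.sum_congr rfl fun i _ => ?_
    split_ifs <;> first | omega | simp
  have hs : ∑ i, (y i - mean y) = 0 := by
    rw [Finset.sum_sub_distrib]
    simp only [mean, Finset.sum_const, Finset.card_univ, Fintype.card_fin, nsmul_eq_mul]
    field_simp
    simp
  have ht : ((n : ℝ) + 1 - k) * ∑ i, tailCoeff n k i * y i
      = ∑ i : Fin (n + 1), y i * (if k ≤ (i : ℕ) then 1 else 0) := by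
    rw [Finset.mul_sum]
    refine Finset.sum_congr rfl fun i _ => ?_
    simp only [tailCoeff]
    split_ifs
    · field_simp
    · simp
  rw [hb, hs, Finset.sum_sub_distrib, ← ht, ← Finset.mul_sum, sum_ite_le k hk, tailDev,
    min_eq_left hk]
  simp only [sub_mul, Finset.sum_sub_distrib]
  rw [hm]
  ring

/-- One-sided tail of the maximum of the Gaussian bridge, or of its negative: the same bound as for
the Brownian bridge. The level `a` of the bridge is the line `a t + a / N` for `tailDev` at time
`t = tailVar n k`. -/
theorem measureReal_exists_le_bridge {a s : ℝ} (ha : 0 ≤ a) (hs : s ^ 2 = 1) :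
    (stdGaussianPi (n + 1)).real {y | ∃ k ≤ n, a ≤ s * bridge y k}
      ≤ Real.exp (-(2 * a ^ 2 / (n + 1))) := by
  have hproc : IsGaussianProcess (fun k y => s * tailDev n k y) (stdGaussianPi (n + 1)) :=
    (isGaussianProcess_linear_stdGaussianPi
      fun k (i : Fin (n + 1)) => tailCoeff n 0 i - tailCoeff n (min k n) i).smul fun _ => s
  have hline := measureReal_exists_line_le (t := tailVar n) hproc ?_ ?_ ?_ ha
    (b := a / (n + 1)) n
  · convert hline using 2
    · ext y
      refine exists_congr fun k => and_congr_right fun hk => ?_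
      have hk' : (k : ℝ) ≤ n := by exact_mod_cast hk
      have h0 : 0 < (n : ℝ) + 1 - k := by linarith
      rw [bridge_eq_mul_tailDev y hk, tailVar, min_eq_left hk,
        show a * (1 / ((n : ℝ) + 1 - k) - 1 / (n + 1)) + a / (n + 1) = a / ((n : ℝ) + 1 - k) by ring,
        div_le_iff₀ h0]
      ring_nf
    · ring
  · intro k
    rw [integral_const_mul]
    have := integral_linear_stdGaussianPi
      fun i : Fin (n + 1) => tailCoeff n 0 i - tailCoeff n (min k n) i
    change s * ∫ y, ∑ i, _ ∂_ = 0
    rw [this, mul_zero]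
  · intro j k
    rw [covariance_const_mul_left, covariance_const_mul_right, covariance_tailDev, ← mul_assoc,
      ← sq, hs, one_mul]
  · intro k
    have : Continuous fun y => s * tailDev n k y := by unfold tailDev; fun_prop
    exact this.stronglyMeasurable

theorem measureReal_lt_minThreshold_le {a : ℝ} (ha : 0 < a) :
    (stdGaussianPi (n + 1)).real {y | a < minThreshold y}
      ≤ 2 * Real.exp (-(2 * a ^ 2 / (n + 1))) := by
  have h1 := measureReal_exists_le_bridge (n := n) (s := 1) ha.le (by norm_num)
  have h2 := measureReal_exists_le_bridge (n := n) (s := -1) ha.le (by norm_num)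
  calc (stdGaussianPi (n + 1)).real {y | a < minThreshold y}
      ≤ (stdGaussianPi (n + 1)).real ({y | ∃ k ≤ n, a ≤ 1 * bridge y k}
          ∪ {y | ∃ k ≤ n, a ≤ -1 * bridge y k}) := by
        refine measureReal_mono fun y hy => ?_
        obtain ⟨k, hk, h | h⟩ := exists_le_bridge_of_lt_minThreshold y ha hy
        · exact Or.inl ⟨k, hk, by linarith⟩
        · exact Or.inr ⟨k, hk, by linarith⟩
    _ ≤ _ := (measureReal_union_le _ _).trans (by linarith)

end GaussianBridge

/-! ### The distribution function of the minimal threshold -/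

section Quantile

variable {n : ℕ}

theorem measurableSet_minThreshold_le (r : ℝ) :
    MeasurableSet {y : Fin (n + 1) → ℝ | minThreshold y ≤ r} :=
  (isClosed_le continuous_minThreshold continuous_const).measurableSet

/-- The distribution function of the minimal threshold is strictly increasing on `[0, ∞)`: the
Gaussian law charges every nonempty open set, and the minimal threshold is continuous and onto
`[0, ∞)`. -/
theorem measureReal_minThreshold_le_lt (hn : 0 < n) {r s : ℝ} (hrs : r < s) (hs : 0 < s) :
    (stdGaussianPi (n + 1)).real {y | minThreshold y ≤ r}
      < (stdGaussianPi (n + 1)).real {y | minThreshold y ≤ s} := by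
  set U : Set (Fin (n + 1) → ℝ) := {y | r < minThreshold y ∧ minThreshold y < s} with hU
  have hopen : IsOpen U := (isOpen_lt continuous_const continuous_minThreshold).inter
    (isOpen_lt continuous_minThreshold continuous_const)
  have hne : U.Nonempty := by
    obtain ⟨q, hq1, hq2⟩ := exists_between (max_lt hrs hs)
    obtain ⟨y, hy⟩ := exists_minThreshold_eq hn ((le_max_right r 0).trans hq1.le)
    exact ⟨y, by rw [hy]; exact (le_max_left r 0).trans_lt hq1, by rwa [hy]⟩
  have hpos : 0 < (stdGaussianPi (n + 1)).real U :=
    ENNReal.toReal_pos (hopen.measure_pos _ hne).ne' (measure_ne_top _ _)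
  have hdisj : Disjoint {y : Fin (n + 1) → ℝ | minThreshold y ≤ r} U :=
    Set.disjoint_left.2 fun y hy hyU => not_lt.2 hy hyU.1
  calc _ < (stdGaussianPi (n + 1)).real {y | minThreshold y ≤ r}
          + (stdGaussianPi (n + 1)).real U := by linarith
    _ = (stdGaussianPi (n + 1)).real ({y | minThreshold y ≤ r} ∪ U) :=
      (measureReal_union hdisj hopen.measurableSet).symm
    _ ≤ _ := measureReal_mono (Set.union_subset (fun y hy => le_trans hy hrs.le)
      fun y hy => hy.2.le)

theorem measureReal_lt_minThreshold (r : ℝ) :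
    (stdGaussianPi (n + 1)).real {y | r < minThreshold y}
      = 1 - (stdGaussianPi (n + 1)).real {y | minThreshold y ≤ r} := by
  rw [← probReal_compl_eq_one_sub (measurableSet_minThreshold_le r)]
  congr 1
  ext y
  simp

/-- In the model `Y = m + ε` with noise level `σ`, the distribution function of the minimal
threshold is that of the standard case, rescaled by `σ`. -/
theorem measureReal_minThreshold_model {Ω : Type*} [MeasurableSpace Ω] {P : Measure Ω}
    [IsProbabilityMeasure P] {m σ : ℝ} (hσ : 0 < σ) {ε Y : Fin (n + 1) → Ω → ℝ}
    (hlaw : ∀ i, HasLaw (ε i) (gaussianReal 0 (Real.toNNReal (σ ^ 2))) P)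
    (hind : iIndepFun ε P) (hY : ∀ i ω, Y i ω = m + ε i ω) (r : ℝ) :
    P.real {ω | minThreshold (fun i => Y i ω) ≤ r}
      = (stdGaussianPi (n + 1)).real {y | minThreshold y ≤ r / σ} := by
  set x : Fin (n + 1) → Ω → ℝ := fun i ω => ε i ω / σ with hx
  have hmeas : ∀ i, AEMeasurable (x i) P := fun i => (hlaw i).aemeasurable.div_const σ
  have hxlaw : ∀ i, P.map (x i) = gaussianReal 0 1 := by
    intro i
    have h1 : P.map (x i) = (P.map (ε i)).map (· / σ) :=
      (AEMeasurable.map_map_of_aemeasurable (g := (· / σ)) (by fun_prop) (hlaw i).aemeasurable).symm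
    rw [h1, (hlaw i).map_eq, gaussianReal_map_div_const, zero_div]
    congr 1
    ext
    rw [NNReal.coe_div, Real.coe_toNNReal _ (sq_nonneg σ)]
    exact div_self (by positivity)
  have hmap : P.map (fun ω i => x i ω) = stdGaussianPi (n + 1) := by
    have hi : iIndepFun x P := hind.comp (fun _ u => u / σ) fun _ => by fun_prop
    rw [hi.map_fun_eq_pi_map hmeas]
    simp_rw [hxlaw]
  have hset : {ω | minThreshold (fun i => Y i ω) ≤ r}
      = (fun ω i => x i ω) ⁻¹' {y | minThreshold y ≤ r / σ} := by
    ext ω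
    have h : (fun i => Y i ω) = fun i => m + σ * x i ω := by
      ext i
      rw [hY, hx]
      field_simp
    change minThreshold (fun i => Y i ω) ≤ r ↔ minThreshold (fun i => x i ω) ≤ r / σ
    rw [h, minThreshold_affine m hσ.le, le_div_iff₀ hσ, mul_comm]
  rw [hset, ← hmap, measureReal_def, measureReal_def, Measure.map_apply_of_aemeasurable
    (aemeasurable_pi_lambda _ hmeas) (measurableSet_minThreshold_le _)]

end Quantile

/-! ### Size of the threshold -/

section Threshold

theorem univThreshold_eq_mul (σ : ℝ) (N : ℕ) : univThreshold σ N = σ * univThreshold 1 N := by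
  simp only [univThreshold]
  ring

theorem one_lt_log_natCast {N : ℕ} (hN : 3 ≤ N) : 1 < Real.log N := by
  have h3 : (3 : ℝ) ≤ N := by exact_mod_cast hN
  rw [Real.lt_log_iff_exp_lt (by linarith)]
  linarith [Real.exp_one_lt_d9]

theorem univThreshold_one_pos {N : ℕ} (hN : 3 ≤ N) : 0 < univThreshold 1 N := by
  have h := Real.log_pos (one_lt_log_natCast hN)
  have : 0 < N := by omega
  unfold univThreshold
  positivity

/-- The threshold is chosen so that the Brownian bridge tail `exp (-2 a² / N)` becomes
`1 / √(log N)`. -/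
theorem exp_neg_univThreshold_sq {N : ℕ} (hN : 3 ≤ N) :
    Real.exp (-(2 * univThreshold 1 N ^ 2 / N)) = 1 / √(Real.log N) := by
  have h1 := one_lt_log_natCast hN
  have hN0 : (N : ℝ) ≠ 0 := by positivity
  have h : 2 * univThreshold 1 N ^ 2 / N = Real.log (Real.log N) / 2 := by
    rw [univThreshold, mul_pow, Real.sq_sqrt (mul_nonneg N.cast_nonneg (Real.log_pos h1).le)]
    field_simp
  rw [h, Real.exp_neg, Real.exp_half, Real.exp_log (by linarith), one_div]

end Threshold

end TVDenoising

/-! ### The universal threshold is a quantile -/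

theorem mainTheorem3 :
    ∃ α : ℕ → ℝ,
      (α =O[atTop] fun N : ℕ => 1 / √(Real.log ((N : ℝ) - 1))) ∧
      ∀ N : ℕ, 3 ≤ N →
        0 < α N ∧ α N < 1 ∧ α N ≤ 2 / √(Real.log N) ∧
        ∀ (Ω : Type*) [MeasurableSpace Ω] (P : Measure Ω) [IsProbabilityMeasure P]
          (m σ : ℝ) (_ : 0 < σ) (ε Y : Fin N → Ω → ℝ)
          (_ : ∀ i, HasLaw (ε i) (gaussianReal 0 (Real.toNNReal (σ ^ 2))) P)
          (_ : iIndepFun ε P)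
          (_ : ∀ i ω, Y i ω = m + ε i ω),
          TVDenoising.IsQuantile P (fun ω => TVDenoising.minThreshold (fun i => Y i ω))
              (1 - α N) (TVDenoising.univThreshold σ N) ∧
          1 - 2 / √(Real.log N) ≤
            P.real {ω | ∀ f : Fin N → ℝ,
              TVDenoising.IsTVEstimate (fun i => Y i ω) (TVDenoising.univThreshold σ N) f ↔
                f = fun _ => TVDenoising.mean (fun i => Y i ω)} := by
  open TVDenoising in
  set α : ℕ → ℝ := fun N => (stdGaussianPi N).real {y | univThreshold 1 N < minThreshold y} with hα
  have hle : ∀ N, 3 ≤ N → α N ≤ 2 / √(Real.log N) := by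
    intro N hN
    obtain ⟨n, rfl⟩ : ∃ n, N = n + 1 := ⟨N - 1, by omega⟩
    have h := measureReal_lt_minThreshold_le (n := n) (univThreshold_one_pos hN)
    have he := exp_neg_univThreshold_sq hN
    rw [Nat.cast_add_one] at he
    rw [he] at h
    rw [Nat.cast_add_one]
    calc α (n + 1) ≤ _ := h
      _ = _ := by ring
  refine ⟨α, ?_, fun N hN => ?_⟩
  · refine IsBigO.of_bound 2 ?_
    filter_upwards [eventually_ge_atTop 3] with N hN
    have h3 : (3 : ℝ) ≤ N := by exact_mod_cast hN
    have hlog : 0 < Real.log ((N : ℝ) - 1) := Real.log_pos (by linarith)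
    rw [Real.norm_of_nonneg measureReal_nonneg, Real.norm_of_nonneg (by positivity)]
    calc α N ≤ 2 / √(Real.log N) := hle N hN
      _ ≤ 2 / √(Real.log ((N : ℝ) - 1)) := by
        have : Real.log ((N : ℝ) - 1) ≤ Real.log N :=
          Real.log_le_log (by linarith) (by linarith)
        gcongr
      _ = _ := by ring
  have hlam := univThreshold_one_pos hN
  have hαle := hle N hN
  obtain ⟨n, rfl⟩ : ∃ n, N = n + 1 := ⟨N - 1, by omega⟩
  have hn : 0 < n := by omega
  have hαF : α (n + 1)
      = 1 - (stdGaussianPi (n + 1)).real {y | minThreshold y ≤ univThreshold 1 (n + 1)} :=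
    measureReal_lt_minThreshold _
  refine ⟨?_, ?_, hαle, ?_⟩
  · have h := measureReal_minThreshold_le_lt hn (lt_add_one (univThreshold 1 (n + 1)))
      (by linarith)
    have h1 : (stdGaussianPi (n + 1)).real {y | minThreshold y ≤ univThreshold 1 (n + 1) + 1} ≤ 1 :=
      measureReal_le_one
    linarith
  · have h := measureReal_minThreshold_le_lt hn (sub_one_lt (univThreshold 1 (n + 1))) hlam
    have h0 : 0 ≤ (stdGaussianPi (n + 1)).real
        {y | minThreshold y ≤ univThreshold 1 (n + 1) - 1} := measureReal_nonneg
    linarith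
  intro Ω _ P _ m σ hσ ε Y hlaw hind hY
  have hF := measureReal_minThreshold_model hσ hlaw hind hY
  have hat : P.real {ω | minThreshold (fun i => Y i ω) ≤ univThreshold σ (n + 1)}
      = 1 - α (n + 1) := by
    rw [hF, univThreshold_eq_mul, mul_div_cancel_left₀ _ hσ.ne', hαF]
    ring
  refine ⟨⟨hat.ge, fun t ht => ?_⟩, ?_⟩
  · by_contra! hlt
    rw [univThreshold_eq_mul, ← div_lt_iff₀' hσ] at hlt
    have h := measureReal_minThreshold_le_lt hn hlt hlam
    have ht' : 1 - α (n + 1) ≤ P.real {ω | minThreshold (fun i => Y i ω) ≤ t} := ht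
    rw [hF] at ht'
    linarith
  · calc 1 - 2 / √(Real.log ((n + 1 : ℕ) : ℝ)) ≤ 1 - α (n + 1) := by linarith
      _ = P.real {ω | minThreshold (fun i => Y i ω) ≤ univThreshold σ (n + 1)} := hat.symm
      _ ≤ _ := measureReal_mono fun ω hω f =>
        isTVEstimate_iff_eq_mean n.succ_pos _ f hω
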